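/- Let $\mathcal D$ be a triangulated category whose Grothendieck group $K(\mathcal D)$ is free of finite rank. Assume that $\mathcal D$ has a split-generator $G$, i.e. the smallest thick (closed under direct summands) triangulated subcategory $\langle G\rangle$ containing $G$ is $\mathcal D$. Let $F\colon\mathcal D\to\mathcal D$ be an exact endofunctor (it commutes with shifts and preserves exact triangles), let $t\in\mathbb R$, and let $\sigma=(Z,\mathcal P)$ be a stability condition on $\mathcal D$ in the sense of Bridgeland with the support property: for some norm on $K(\mathcal D)\otimes\mathbb R$ and some $C>0$, every nonzero $E$ in any $\mathcal P(\phi)$ satisfies $|Z(E)|>C\,\|[E]\|$. For $E\neq 0$ with Harder–Narasimhan factors $A_1,\dots,A_m$ of phases $\phi_1>\dots>\phi_m$ put $m_{\sigma,t}(E)=\sum_{i}|Z(A_i)|e^{\phi_i t}$, and put $m_{\sigma,t}(0)=0$, $\log 0=-\infty$. The mass growth of $F$ is $$h_{\sigma,t}(F)=\sup_{E\in\mathcal D}\ \limsup_{n\to\infty}\frac1n\log m_{\sigma,t}(F^nE)\in[-\infty,\infty].$$ For objects $E_1,E_2$ let $\delta_t(E_1,E_2)\in[0,\infty]$ be $0$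 if $E_2\cong0$, be $\infty$ if $E_2\notin\langle E_1\rangle$, and otherwise be the infimum of $\sum_{i=1}^k e^{n_it}$ over all sequences of exact triangles $A_{i-1}\to A_i\to E_1[n_i]\to A_{i-1}[1]$ $(1\le i\le k)$ with $A_0=0$ and $A_k=E_2\oplus E_2'$ for some object $E_2'$. The categorical entropy of $F$ is $h_t(F)=\lim_{n\to\infty}\frac1n\log\delta_t(G,F^nG)$. Then: (1) $\displaystyle h_{\sigma,t}(F)=\limsup_{n\to\infty}\frac1n\log m_{\sigma,t}(F^nG)$. (2) The limit $h_t(F)$ exists in $[-\infty,\infty]$, is the same for every split-generator of $\mathcal D$, and $$h_{\sigma,t}(F)\le h_t(F)<\infty.$$ -/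

import Mathlib

open CategoryTheory Limits Pretriangulated Filter Topology
open scoped ENNReal TensorProduct

universe v u

noncomputable section

namespace TriangulatedMass

variable (D : Type u) [Category.{v} D] [HasZeroObject D] [HasShift D ℤ] [Preadditive D]
  [∀ n : ℤ, (shiftFunctor D n).Additive] [Pretriangulated D]

/-- The Grothendieck group of a triangulated category: the free abelian group on the objects
modulo `[B] = [A] + [C]` for every exact triangle `A ⟶ B ⟶ C ⟶ A⟦1⟧`. -/
abbrev K₀ : Type u :=
  FreeAbelianGroup D ⧸ AddSubgroup.closure
    {x : FreeAbelianGroup D | ∃ T ∈ distTriang D,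
      x = FreeAbelianGroup.of T.obj₂ - FreeAbelianGroup.of T.obj₁ - FreeAbelianGroup.of T.obj₃}

variable {D}

/-- The class of an object in the Grothendieck group. -/
def K₀.cls (E : D) : K₀ D := QuotientAddGroup.mk (FreeAbelianGroup.of E)

/-- `Tower E [X_k, …, X_1]`: there is a sequence of exact triangles
`E_{i-1} ⟶ E_i ⟶ X_i ⟶ E_{i-1}⟦1⟧` for `i = 1, …, k` with `E_0 = 0` and `E_k = E`.
The list of cones starts with the *last* one. -/
inductive Tower : D → List D → Prop
  | zero {E : D} (h : IsZero E) : Tower E []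
  | step {E' E X : D} {L : List D} (h : Tower E' L) (f : E' ⟶ E) (g : E ⟶ X)
      (d : X ⟶ E'⟦(1 : ℤ)⟧) (hT : Triangle.mk f g d ∈ distTriang D) : Tower E (X :: L)

/-- `⟨E⟩`: the smallest thick triangulated subcategory containing `E`. -/
def thick (E : D) : ObjectProperty D := (ObjectProperty.singleton E).triangEnvelope

/-- `G` is a split-generator if `⟨G⟩` is the whole category. -/
def IsSplitGenerator (G : D) : Prop := ∀ E : D, thick G E

open Classical in
/-- The complexity `δ_t(E₁, E₂) ∈ [0, ∞]` of `E₂` relative to `E₁`: the infimum of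
`∑ exp (n_i t)` over all towers with cones `E₁[n_i]` which end at some `E₂ ⊞ E'`. -/
def complexity (t : ℝ) (E₁ E₂ : D) : ℝ≥0∞ :=
  if IsZero E₂ then 0
  else if thick E₁ E₂ then
    ⨅ (ns : List ℤ) (E' : D) (_ : Tower (E₂ ⊞ E') (ns.map fun n => E₁⟦n⟧)),
      ENNReal.ofReal (ns.map fun n => Real.exp ((n : ℝ) * t)).sum
  else ⊤

/-- `h` is the entropy `h_t(F)`: the category has a split-generator, and
`(1/n) log δ_t(G, Fⁿ G)` converges to `h` in `[-∞, ∞]` for every split-generator `G`. -/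
def IsEntropy (F : D ⥤ D) (t : ℝ) (h : EReal) : Prop :=
  (∃ G : D, IsSplitGenerator G) ∧ ∀ G : D, IsSplitGenerator G →
    Tendsto (fun n : ℕ => ENNReal.log (complexity t G (F.obj^[n] G)) / (n : EReal)) atTop (𝓝 h)

/-- `L = [(φ_m, A_m), …, (φ_1, A_1)]` is the list of phases and factors of a
Harder–Narasimhan filtration of `E` with respect to the slices `P φ`: the `A_i` are nonzero
objects of `P φ_i`, `φ_1 > ⋯ > φ_m`, and the `A_i` are the cones of a tower ending at `E`. -/
structure IsHNFiltration (P : ℝ → ObjectProperty D) (E : D) (L : List (ℝ × D)) : Prop where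
  tower : Tower E (L.map Prod.snd)
  phases : L.Pairwise fun a b => a.1 < b.1
  semistable : ∀ a ∈ L, P a.1 a.2 ∧ ¬ IsZero a.2

variable (D) in
/-- Bridgeland stability conditions with the support property. The slices `P φ` are
(strictly) full additive subcategories. -/
structure StabilityCondition where
  /-- the central charge -/
  Z : K₀ D →+ ℂ
  /-- the slicing -/
  P : ℝ → ObjectProperty D
  closed_iso : ∀ φ, (P φ).IsClosedUnderIsomorphisms
  zero_mem : ∀ φ (E : D), IsZero E → P φ E
  biprod_mem : ∀ φ (E E' : D), P φ E → P φ E' → P φ (E ⊞ E')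
  charge : ∀ φ (E : D), P φ E → ¬ IsZero E →
    ∃ m : ℝ, 0 < m ∧ Z (K₀.cls E) = m * Complex.exp (Complex.I * Real.pi * φ)
  shift : ∀ φ (E : D), P (φ + 1) (E⟦(1 : ℤ)⟧) ↔ P φ E
  hom_zero : ∀ φ₁ φ₂ (A₁ A₂ : D), φ₂ < φ₁ → P φ₁ A₁ → P φ₂ A₂ → ∀ f : A₁ ⟶ A₂, f = 0
  exists_hn : ∀ E : D, ¬ IsZero E → ∃ L : List (ℝ × D), IsHNFiltration P E L
  support : ∃ N : Seminorm ℝ (ℝ ⊗[ℤ] K₀ D), (∀ x, N x = 0 → x = 0) ∧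
    ∃ C : ℝ, 0 < C ∧ ∀ φ (E : D), P φ E → ¬ IsZero E →
      C * N (1 ⊗ₜ[ℤ] K₀.cls E) < ‖Z (K₀.cls E)‖

namespace StabilityCondition

open Classical in
/-- The mass `m_{σ,t}(E) = ∑ |Z(A_i)| exp (φ_i t)`, the sum over the semistable factors of a
Harder–Narasimhan filtration of `E` (which is unique up to isomorphism). -/
def mass (σ : StabilityCondition D) (t : ℝ) (E : D) : ℝ :=
  if h : IsZero E then 0
  else ((σ.exists_hn E h).choose.map fun a => ‖σ.Z (K₀.cls a.2)‖ * Real.exp (a.1 * t)).sum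

/-- `limsup (1/n) log m_{σ,t}(Fⁿ E)`, with `log 0 = -∞`. -/
def massGrowthAt (σ : StabilityCondition D) (t : ℝ) (F : D ⥤ D) (E : D) : EReal :=
  limsup (fun n : ℕ => ENNReal.log (ENNReal.ofReal (σ.mass t (F.obj^[n] E))) / (n : EReal)) atTop

/-- The mass growth `h_{σ,t}(F)`: the supremum over all objects. -/
def massGrowth (σ : StabilityCondition D) (t : ℝ) (F : D ⥤ D) : EReal :=
  ⨆ E : D, σ.massGrowthAt t F E

end StabilityCondition

end TriangulatedMass

end

/-! The core is the triangle inequality `m(E) ≤ m(A) + m(B)` for exact triangles `A → E → B`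
(`mass_le_add`), together with `m(A) ≤ m(A ⊞ B)` (`mass_le_biprod`). With `mass_shift` they show
that a summand of a tower with cones `G[n_i]` has mass at most `(∑ exp (n_i t)) m(G)`
(`mass_le_mul`). Applying `Fⁿ` to one such tower for `E` bounds `m(Fⁿ E)` by a constant times `m(Fⁿ
G)`, which gives (1). Taking the infimum over towers for `Fⁿ G` bounds `m(Fⁿ G)` by a constant times
`δ(G, Fⁿ G)`, the inequality in (2). The limit exists because `δ` is submultiplicative (Fekete); two
split-generators give complexities comparable up to constants.

For the triangle inequality, consider the height `φ ↦ Im (exp (-iπφ) Z(τ_{>φ} E)) = ∑ |Z(A_i)| sin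
(π (φ_i - φ)₊)`. As a function of `φ`, `sin (π (a - φ)₊)` solves `h'' + π² h = π δ_a`, so
integrating it against `exp (tφ)` recovers `exp (at)` up to boundary terms; summed over the factors
these depend only on the class of `E` (`massSum_eq`). Hence pointwise inequalities of heights give
inequalities of masses (`massSum_le`). Heights are subadditive (`height_le`) because the octahedral
axiom confines the defect to an object with phases in `(φ, φ + 1]`, whose rotated charge has
nonnegative imaginary part. -/

noncomputable section

namespace TriangulatedMass

/-! ### Exponential growth rates in `[-∞, ∞]`. -/

/-- Fekete's lemma for submultiplicative sequences in `[0, ∞)`, with `log 0 = -∞`. -/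
lemma exists_tendsto_log_div {u : ℕ → ℝ≥0∞} (hu : ∀ n, u n ≠ ⊤)
    (hmul : ∀ m n, u (m + n) ≤ u m * u n) :
    ∃ h : EReal, Tendsto (fun n : ℕ => ENNReal.log (u n) / (n : EReal)) atTop (𝓝 h) ∧ h < ⊤ := by
  -- One zero term forces all later terms to vanish, and the limit is `-∞`.
  by_cases h0 : ∃ k, u k = 0
  · obtain ⟨k, hk⟩ := h0
    refine ⟨⊥, tendsto_const_nhds.congr' ?_, bot_lt_top⟩
    filter_upwards [eventually_ge_atTop k, eventually_gt_atTop 0] with n hn hn0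
    obtain ⟨m, rfl⟩ := Nat.exists_eq_add_of_le hn
    have : u (k + m) = 0 := by simpa [hk] using hmul k m
    rw [this, ENNReal.log_zero, EReal.bot_div_of_pos_ne_top (by exact_mod_cast hn0)
      (EReal.natCast_ne_top _)]
  · push Not at h0
    have hpos : ∀ n, 0 < (u n).toReal := fun n => ENNReal.toReal_pos (h0 n) (hu n)
    have hsub : Subadditive fun n => Real.log (u n).toReal := fun m n => by
      rw [← Real.log_mul (hpos m).ne' (hpos n).ne', ← ENNReal.toReal_mul]
      exact Real.log_le_log (hpos _)
        (ENNReal.toReal_mono (ENNReal.mul_ne_top (hu m) (hu n)) (hmul m n))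
    have heq : ∀ n : ℕ, ENNReal.log (u n) / (n : EReal) =
        ((Real.log (u n).toReal / n : ℝ) : EReal) := fun n => by
      rw [ENNReal.log_pos_real (h0 n) (hu n), EReal.coe_div]
      rfl
    simp only [heq]
    -- The index is shifted because the quotient at `0` is a junk value. The infimum is taken in
    -- `EReal` since the sequence need not be bounded below.
    refine ⟨⨅ n : ℕ, ((Real.log (u (n + 1)).toReal / (n + 1 : ℕ) : ℝ) : EReal), ?_,
      (iInf_le _ 0).trans_lt (EReal.coe_lt_top _)⟩
    refine tendsto_order.2 ⟨fun a ha => ?_, fun b hb => ?_⟩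
    · filter_upwards [eventually_gt_atTop 0] with n hn
      obtain ⟨m, rfl⟩ := Nat.exists_eq_succ_of_ne_zero hn.ne'
      exact ha.trans_le (iInf_le _ m)
    · obtain ⟨n, hn⟩ := iInf_lt_iff.1 hb
      obtain ⟨q, hq, hqb⟩ := EReal.lt_iff_exists_real_btwn.1 hn
      filter_upwards [hsub.eventually_div_lt_of_div_lt n.succ_ne_zero
        (EReal.coe_lt_coe_iff.1 hq)] with p hp
      exact (EReal.coe_lt_coe_iff.2 hp).trans hqb

/-- Exponential growth rates are not affected by a constant factor. -/
lemma limsup_log_div_le {a b : ℕ → ℝ≥0∞} {c : ℝ≥0∞} (hc : c ≠ ⊤) (h : ∀ n, a n ≤ c * b n) :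
    limsup (fun n : ℕ => ENNReal.log (a n) / (n : EReal)) atTop ≤
      limsup (fun n : ℕ => ENNReal.log (b n) / (n : EReal)) atTop := by
  -- Replacing `c` by `c + 1` makes the logarithm finite even if `c = 0`.
  have hc0 : c + 1 ≠ 0 := by simp
  have hc1 : c + 1 ≠ ⊤ := by simp [hc]
  have hlim : Tendsto (fun n : ℕ => ENNReal.log (c + 1) / (n : EReal)) atTop (𝓝 0) := by
    rw [ENNReal.log_pos_real hc0 hc1]
    exact EReal.tendsto_coe.2 (tendsto_const_div_atTop_nhds_zero_nat (Real.log (c + 1).toReal))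
  calc
    _ ≤ limsup ((fun n : ℕ => ENNReal.log (c + 1) / (n : EReal)) +
        fun n : ℕ => ENNReal.log (b n) / (n : EReal)) atTop := by
      refine limsup_le_limsup (Eventually.of_forall fun n => ?_)
      rw [Pi.add_apply, ← EReal.add_div_of_nonneg_right (by positivity), ← ENNReal.log_mul_add]
      refine EReal.div_le_div_right_of_nonneg (by positivity) (ENNReal.log_le_log ?_)
      exact (h n).trans (by gcongr; exact le_self_add)
    _ ≤ _ := by
      refine (EReal.limsup_add_le (.inl ?_) (.inl ?_)).trans_eq ?_ <;> simp [hlim.limsup_eq]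

/-! ### Extensions and the octahedral axiom. -/

variable {D : Type u} [Category.{v} D] [HasZeroObject D] [HasShift D ℤ] [Preadditive D]
  [∀ n : ℤ, (shiftFunctor D n).Additive] [Pretriangulated D]

/-- `E` is an extension of `B` by `A`: there is an exact triangle `A ⟶ E ⟶ B ⟶ A⟦1⟧`. -/
def IsExt (A E B : D) : Prop :=
  ∃ (f : A ⟶ E) (g : E ⟶ B) (d : B ⟶ A⟦(1 : ℤ)⟧), Triangle.mk f g d ∈ distTriang D

namespace IsExt

variable {A E B : D}

lemma of_iso {A' E' B' : D} (h : IsExt A E B) (a : A ≅ A') (e : E ≅ E') (b : B ≅ B') :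
    IsExt A' E' B' := by
  obtain ⟨f, g, d, hT⟩ := h
  refine ⟨a.inv ≫ f ≫ e.hom, e.inv ≫ g ≫ b.hom, b.inv ≫ d ≫ a.hom⟦(1 : ℤ)⟧', ?_⟩
  refine isomorphic_distinguished _ hT _ (Triangle.isoMk _ _ a.symm e.symm b.symm ?_ ?_ ?_)
  · change (a.inv ≫ f ≫ e.hom) ≫ e.inv = a.inv ≫ f
    simp
  · change (e.inv ≫ g ≫ b.hom) ≫ b.inv = e.inv ≫ g
    simp
  · change (b.inv ≫ d ≫ a.hom⟦(1 : ℤ)⟧') ≫ a.inv⟦(1 : ℤ)⟧' = b.inv ≫ d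
    simp [← Functor.map_comp]

lemma zero_right (e : A ≅ E) (hB : IsZero B) : IsExt A E B :=
  ⟨e.hom, 0, 0, isomorphic_distinguished _ (contractible_distinguished A) _
    (Triangle.isoMk _ _ (Iso.refl _) e.symm (hB.iso (isZero_zero D))
      (by change e.hom ≫ e.inv = 𝟙 A ≫ 𝟙 A; simp)
      ((isZero_zero D).eq_of_tgt _ _) (hB.eq_of_src _ _))⟩

lemma zero_left (hA : IsZero A) (e : E ≅ B) : IsExt A E B :=
  ⟨0, e.hom, 0, isomorphic_distinguished _ (contractible_distinguished₁ B) _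
    (Triangle.isoMk _ _ (hA.iso (isZero_zero D)) e (Iso.refl _) (hA.eq_of_src _ _)
      (by change e.hom ≫ 𝟙 B = e.hom ≫ 𝟙 B; rfl)
      (((shiftFunctor D (1 : ℤ)).map_isZero (isZero_zero D)).eq_of_tgt _ _))⟩

lemma biprod (A B : D) : IsExt A (A ⊞ B) B :=
  ⟨_, _, _, binaryBiproductTriangle_distinguished A B⟩

lemma rotate (h : IsExt A E B) : IsExt E B (A⟦(1 : ℤ)⟧) := by
  obtain ⟨f, g, d, hT⟩ := h
  exact ⟨_, _, _, rot_of_distTriang _ hT⟩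

lemma shift (h : IsExt A E B) (n : ℤ) : IsExt (A⟦n⟧) (E⟦n⟧) (B⟦n⟧) := by
  obtain ⟨f, g, d, hT⟩ := h
  exact ⟨_, _, _, Triangle.shift_distinguished _ hT n⟩

lemma map {D' : Type*} [Category* D'] [HasZeroObject D'] [HasShift D' ℤ] [Preadditive D']
    [∀ n : ℤ, (shiftFunctor D' n).Additive] [Pretriangulated D']
    (h : IsExt A E B) (F : D ⥤ D') [F.CommShift ℤ] [F.IsTriangulated] :
    IsExt (F.obj A) (F.obj E) (F.obj B) := by
  obtain ⟨f, g, d, hT⟩ := h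
  exact ⟨_, _, _, F.map_distinguished _ hT⟩

lemma cls (h : IsExt A E B) : K₀.cls E = K₀.cls A + K₀.cls B := by
  obtain ⟨f, g, d, hT⟩ := h
  rw [K₀.cls, K₀.cls, K₀.cls, ← QuotientAddGroup.mk_add, eq_comm, QuotientAddGroup.eq]
  refine AddSubgroup.subset_closure ⟨_, hT, ?_⟩
  change _ = FreeAbelianGroup.of E - FreeAbelianGroup.of A - FreeAbelianGroup.of B
  abel

lemma iso_left (h : IsExt A E B) (hB : IsZero B) : Nonempty (A ≅ E) := by
  obtain ⟨f, g, d, hT⟩ := h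
  have : IsIso f := (Triangle.isZero₃_iff_isIso₁ _ hT).1 hB
  exact ⟨asIso f⟩

/-- The product over `WalkingPair` as a biproduct. -/
def _root_.CategoryTheory.Limits.piWalkingPairIso {C : Type*} [Category* C] [HasZeroMorphisms C]
    (X : WalkingPair → C) [HasProduct X] [HasBinaryBiproduct (X .left) (X .right)] :
    ∏ᶜ X ≅ X .left ⊞ X .right where
  hom := biprod.lift (Pi.π X .left) (Pi.π X .right)
  inv := Pi.lift fun j => match j with
    | .left => biprod.fst
    | .right => biprod.snd
  hom_inv_id := by
    ext (_ | _) <;> simp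
  inv_hom_id := by
    ext <;> simp

lemma biprod_biprod {A' E' B' : D} (h : IsExt A E B) (h' : IsExt A' E' B') :
    IsExt (A ⊞ A') (E ⊞ E') (B ⊞ B') := by
  obtain ⟨f, g, d, hT⟩ := h
  obtain ⟨f', g', d', hT'⟩ := h'
  let T : WalkingPair → Triangle D := fun j =>
    WalkingPair.casesOn j (Triangle.mk f g d) (Triangle.mk f' g' d')
  have key : IsExt (∏ᶜ fun j => (T j).obj₁) (∏ᶜ fun j => (T j).obj₂) (∏ᶜ fun j => (T j).obj₃) :=
    ⟨_, _, _, productTriangle_distinguished T (by rintro (_ | _) <;> assumption)⟩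
  exact key.of_iso (piWalkingPairIso _) (piWalkingPairIso _) (piWalkingPairIso _)

variable [IsTriangulated D]

/-- If `X ⊆ A ⊆ E` with `A / X = Y` and `E / A = B`, then `Y ⊆ E / X` with quotient `B`. -/
lemma quotient {X Y : D} (h : IsExt A E B) (h' : IsExt X A Y) :
    ∃ C, IsExt X E C ∧ IsExt Y C B := by
  obtain ⟨f, g, d, hT⟩ := h
  obtain ⟨f', g', d', hT'⟩ := h'
  obtain ⟨C, p, q, hC⟩ := distinguished_cocone_triangle (f' ≫ f)
  exact ⟨C, ⟨_, _, _, hC⟩, ⟨_, _, _, (Triangulated.someOctahedron rfl hT' hT hC).mem⟩⟩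

/-- The preimage of `X ⊆ B` under `E ⟶ B`. -/
lemma preimage {X Y : D} (h : IsExt A E B) (h' : IsExt X B Y) :
    ∃ C, IsExt C E Y ∧ IsExt A C X := by
  obtain ⟨f, g, d, hT⟩ := h
  obtain ⟨f', g', d', hT'⟩ := h'
  obtain ⟨C, p, q, hC⟩ := distinguished_cocone_triangle₁ (g ≫ g')
  exact ⟨C, ⟨_, _, _, hC⟩, ⟨_, _, _, (Triangulated.someOctahedron' rfl hT hT' hC).mem⟩⟩

end IsExt

lemma _root_.CategoryTheory.Limits.IsZero.cls_eq_zero {E : D} (h : IsZero E) : K₀.cls E = 0 := by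
  simpa using (IsExt.zero_left h (Iso.refl E)).cls

/-! ### Towers and their direct summands. -/

namespace Tower

lemma step_ext {E' E X : D} {L : List D} (h : Tower E' L) (h' : IsExt E' E X) :
    Tower E (X :: L) := by
  obtain ⟨f, g, d, hT⟩ := h'
  exact h.step f g d hT

lemma induction_ext {motive : (E : D) → (L : List D) → Tower E L → Prop}
    (zero : ∀ {E : D} (h : IsZero E), motive E [] (.zero h))
    (step : ∀ {E' E X : D} {L : List D} (h : Tower E' L) (h' : IsExt E' E X), motive E' L h →
      motive E (X :: L) (h.step_ext h')) {E : D} {L : List D} (h : Tower E L) : motive E L h := by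
  induction h with
  | zero h => exact zero h
  | step h f g d hT ih => exact step h ⟨f, g, d, hT⟩ ih

lemma of_iso {E E' : D} {L : List D} (h : Tower E L) (e : E ≅ E') : Tower E' L := by
  cases h with
  | zero h => exact .zero (h.of_iso e.symm)
  | step h f g d hT =>
    exact h.step_ext (IsExt.of_iso ⟨f, g, d, hT⟩ (Iso.refl _) e (Iso.refl _))

lemma congr {E : D} {L L' : List D} (h : Tower E L)
    (hL : List.Forall₂ (fun X Y => Nonempty (X ≅ Y)) L L') : Tower E L' := by
  induction h using induction_ext generalizing L' with
  | zero h => cases hL; exact .zero h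
  | step _ h' ih =>
    cases hL with
    | cons e hL => exact (ih hL).step_ext (h'.of_iso (Iso.refl _) (Iso.refl _) e.some)

lemma single (E : D) : Tower E [E] :=
  (Tower.zero (isZero_zero D)).step_ext (IsExt.zero_left (isZero_zero D) (Iso.refl E))

/-- The tower of `B` is pulled back along `E ⟶ B`, one step at a time, and placed on top of that of
`A`. -/
lemma append [IsTriangulated D] {A E B : D} {L L' : List D} (hA : Tower A L) (hB : Tower B L')
    (h : IsExt A E B) : Tower E (L' ++ L) := by
  induction hB using induction_ext generalizing E with
  | zero hB => exact hA.of_iso (h.iso_left hB).some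
  | step _ h' ih =>
    obtain ⟨C, hC, hC'⟩ := h.preimage h'
    exact (ih hC').step_ext hC

lemma shift {E : D} {L : List D} (h : Tower E L) (n : ℤ) :
    Tower (E⟦n⟧) (L.map fun X => X⟦n⟧) := by
  induction h using induction_ext with
  | zero h => exact .zero ((shiftFunctor D n).map_isZero h)
  | step _ h' ih => exact ih.step_ext (h'.shift n)

lemma map {E : D} {L : List D} (h : Tower E L) (F : D ⥤ D) [F.CommShift ℤ] [F.IsTriangulated] :
    Tower (F.obj E) (L.map F.obj) := by
  induction h using induction_ext with
  | zero h => exact .zero (F.map_isZero h)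
  | step _ h' ih => exact ih.step_ext (h'.map F)

lemma cls {E : D} {L : List D} (h : Tower E L) : K₀.cls E = (L.map K₀.cls).sum := by
  induction h using induction_ext with
  | zero h => simp [h.cls_eq_zero]
  | step _ h' ih => rw [h'.cls, ih, List.map_cons, List.sum_cons, add_comm]

end Tower

/-- `E` is a direct summand of an object with a tower whose cones are the members of `L`. -/
def Built (E : D) (L : List D) : Prop := ∃ W, Tower W L ∧ Nonempty (Retract E W)

namespace Built

variable {E : D} {L : List D}

lemma of_retract {E' : D} (h : Built E L) (r : Retract E' E) : Built E' L := by
  obtain ⟨W, hW, ⟨s⟩⟩ := h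
  exact ⟨W, hW, ⟨r.trans s⟩⟩

lemma of_tower (h : Tower E L) : Built E L := ⟨E, h, ⟨.refl E⟩⟩

lemma congr {L' : List D} (h : Built E L)
    (hL : List.Forall₂ (fun X Y => Nonempty (X ≅ Y)) L L') : Built E L' := by
  obtain ⟨W, hW, r⟩ := h
  exact ⟨W, hW.congr hL, r⟩

lemma shift (h : Built E L) (n : ℤ) : Built (E⟦n⟧) (L.map fun X => X⟦n⟧) := by
  obtain ⟨W, hW, ⟨r⟩⟩ := h
  exact ⟨_, hW.shift n, ⟨r.map _⟩⟩

lemma map (h : Built E L) (F : D ⥤ D) [F.CommShift ℤ] [F.IsTriangulated] :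
    Built (F.obj E) (L.map F.obj) := by
  obtain ⟨W, hW, ⟨r⟩⟩ := h
  exact ⟨_, hW.map F, ⟨r.map F⟩⟩

/-- The inclusion of a retract is a monomorphism, so its triangle splits and the cone is a
complement; idempotent completeness is not needed. -/
lemma exists_biprod (h : Built E L) : ∃ E', Tower (E ⊞ E') L := by
  obtain ⟨W, hW, ⟨r⟩⟩ := h
  obtain ⟨C, g, d, hT⟩ := distinguished_cocone_triangle r.i
  have hd : d = 0 := Triangle.mor₃_eq_zero_of_mono₁ _ hT (inferInstanceAs (Mono r.i))
  obtain ⟨e, -⟩ := exists_iso_binaryBiproduct_of_distTriang _ hT hd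
  exact ⟨C, hW.of_iso e⟩

lemma of_biprod {E' : D} (h : Tower (E ⊞ E') L) : Built E L :=
  ⟨_, h, ⟨⟨biprod.inl, biprod.fst, by simp⟩⟩⟩

/-- The class `d : B ⟶ A⟦1⟧` is transported to `W ⟶ V⟦1⟧`, giving an extension `U` with maps `E ⟶ U
⟶ E`. The composite need not be the identity, but it is an isomorphism by the five lemma, and
correcting by its inverse makes `E` a retract of `U`. -/
lemma append [IsTriangulated D] {A B : D} {L L' : List D} (hA : Built A L) (hB : Built B L')
    (h : IsExt A E B) : Built E (L' ++ L) := by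
  obtain ⟨V, hV, ⟨r⟩⟩ := hA
  obtain ⟨W, hW, ⟨s⟩⟩ := hB
  obtain ⟨f, g, d, hT⟩ := h
  obtain ⟨U, p, q, hU⟩ := distinguished_cocone_triangle₂ (s.r ≫ d ≫ r.i⟦(1 : ℤ)⟧')
  obtain ⟨i, hi₁, hi₂⟩ := complete_distinguished_triangle_morphism₂ _ _ hT hU r.i s.i
    (by change d ≫ r.i⟦(1 : ℤ)⟧' = s.i ≫ s.r ≫ d ≫ r.i⟦(1 : ℤ)⟧'; simp)
  obtain ⟨j, hj₁, hj₂⟩ := complete_distinguished_triangle_morphism₂ _ _ hU hT r.r s.r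
    (by
      change (s.r ≫ d ≫ r.i⟦(1 : ℤ)⟧') ≫ r.r⟦(1 : ℤ)⟧' = s.r ≫ d
      simp [← Functor.map_comp])
  change E ⟶ U at i
  change U ⟶ E at j
  change f ≫ i = r.i ≫ p at hi₁
  change g ≫ s.i = i ≫ q at hi₂
  change p ≫ j = r.r ≫ f at hj₁
  change q ≫ s.r = j ≫ g at hj₂
  let φ : Triangle.mk f g d ⟶ Triangle.mk f g d :=
    { hom₁ := 𝟙 _
      hom₂ := i ≫ j
      hom₃ := 𝟙 _
      comm₁ := by
        change f ≫ i ≫ j = 𝟙 _ ≫ f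
        simp [reassoc_of% hi₁, hj₁]
      comm₂ := by
        change g ≫ 𝟙 _ = (i ≫ j) ≫ g
        simp [← hj₂, ← reassoc_of% hi₂]
      comm₃ := by
        change d ≫ (𝟙 A)⟦(1 : ℤ)⟧' = 𝟙 _ ≫ d
        simp }
  have : IsIso (i ≫ j) := isIso₂_of_isIso₁₃ φ hT hT
    (inferInstanceAs (IsIso (𝟙 _))) (inferInstanceAs (IsIso (𝟙 _)))
  exact ⟨U, hV.append hW ⟨p, q, _, hU⟩, ⟨⟨i, j ≫ inv (i ≫ j), by
    rw [← Category.assoc, IsIso.hom_inv_id]⟩⟩⟩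

/-- Objects of `⟨G⟩` are built from shifts of `G`. -/
lemma of_thick [IsTriangulated D] {G : D} (h : thick G E) :
    ∃ ns : List ℤ, Built E (ns.map fun n => G⟦n⟧) := by
  let Q : ObjectProperty D := fun E => ∃ ns : List ℤ, Built E (ns.map fun n => G⟦n⟧)
  have hret : Q.IsStableUnderRetracts :=
    ⟨fun r ⟨ns, h⟩ => ⟨ns, h.of_retract r⟩⟩
  have hzero : Q.ContainsZero := ⟨⟨_, isZero_zero D, [], of_tower (.zero (isZero_zero D))⟩⟩
  have hshift : Q.IsStableUnderShift ℤ := by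
    refine ⟨fun a => ⟨fun E ⟨ns, h⟩ => ⟨ns.map (· + a), (h.shift a).congr ?_⟩⟩⟩
    simp only [List.map_map, List.forall₂_map_left_iff, List.forall₂_map_right_iff,
      List.forall₂_same]
    intro n _
    exact ⟨((shiftFunctorAdd D n a).app G).symm⟩
  have hext : Q.IsTriangulatedClosed₂ := by
    refine .mk' fun T hT ⟨ns, h⟩ ⟨ms, h'⟩ => ⟨ms ++ ns, ?_⟩
    rw [List.map_append]
    exact h.append h' ⟨T.mor₁, T.mor₂, T.mor₃, hT⟩
  have : Q.IsTriangulated := ⟨⟩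
  refine (ObjectProperty.triangEnvelope_le_iff (ObjectProperty.singleton G) (Q := Q)).2 ?_ E h
  rintro _ ⟨⟩
  refine ⟨[0], ?_⟩
  exact (of_tower (Tower.single _)).congr (.cons ⟨((shiftFunctorZero D ℤ).app G).symm⟩ .nil)

end Built

/-! ### Truncations with respect to the slicing. -/

lemma Tower.hom_eq_zero_of_left {X Y : D} {L : List D} (h : Tower X L)
    (hL : ∀ A ∈ L, ∀ f : A ⟶ Y, f = 0) (f : X ⟶ Y) : f = 0 := by
  induction h with
  | zero h => exact h.eq_of_src _ _
  | step h p q d hT ih =>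
    obtain ⟨g, rfl⟩ := Triangle.yoneda_exact₂ _ hT f
      (ih (fun A hA => hL A (List.mem_cons_of_mem _ hA)) _)
    exact (congrArg (q ≫ ·) (hL _ List.mem_cons_self g)).trans comp_zero

lemma Tower.hom_eq_zero_of_right {X Y : D} {L : List D} (h : Tower Y L)
    (hL : ∀ A ∈ L, ∀ f : X ⟶ A, f = 0) (f : X ⟶ Y) : f = 0 := by
  induction h with
  | zero h => exact h.eq_of_tgt _ _
  | step h p q d hT ih =>
    obtain ⟨g, rfl⟩ := Triangle.coyoneda_exact₂ _ hT f (hL _ List.mem_cons_self _)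
    exact (congrArg (· ≫ p) (ih (fun A hA => hL A (List.mem_cons_of_mem _ hA)) g)).trans zero_comp

namespace StabilityCondition

variable (σ : StabilityCondition D)

/-- The extension closure of the semistable objects with phases in `S`. -/
def Gen (S : Set ℝ) (E : D) : Prop :=
  ∃ L : List (ℝ × D), Tower E (L.map Prod.snd) ∧ ∀ a ∈ L, a.1 ∈ S ∧ σ.P a.1 a.2

variable {σ}

namespace Gen

variable {S : Set ℝ} {E : D}

lemma of_isZero (h : IsZero E) : σ.Gen S E := ⟨[], .zero h, by simp⟩

lemma mono {S' : Set ℝ} (h : σ.Gen S E) (hS : S ⊆ S') : σ.Gen S' E := by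
  obtain ⟨L, hL, hP⟩ := h
  exact ⟨L, hL, fun a ha => ⟨hS (hP a ha).1, (hP a ha).2⟩⟩

lemma ext [IsTriangulated D] {A B : D} (hA : σ.Gen S A) (hB : σ.Gen S B) (h : IsExt A E B) :
    σ.Gen S E := by
  obtain ⟨L, hL, hP⟩ := hA
  obtain ⟨L', hL', hP'⟩ := hB
  refine ⟨L' ++ L, by simpa using hL.append hL' h, fun a ha => ?_⟩
  rcases List.mem_append.1 ha with ha | ha
  exacts [hP' a ha, hP a ha]

lemma shift (h : σ.Gen S E) : σ.Gen ((fun φ => φ - 1) ⁻¹' S) (E⟦(1 : ℤ)⟧) := by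
  obtain ⟨L, hL, hP⟩ := h
  refine ⟨L.map fun a => (a.1 + 1, a.2⟦(1 : ℤ)⟧), ?_, ?_⟩
  · simpa [Function.comp_def] using hL.shift 1
  · simp only [List.mem_map, forall_exists_index, and_imp, forall_apply_eq_imp_iff₂]
    exact fun a ha => ⟨by simpa using (hP a ha).1, (σ.shift _ _).2 (hP a ha).2⟩

lemma hom_eq_zero {X Y : D} {φ : ℝ} (hX : σ.Gen (Set.Ioi φ) X) (hY : σ.Gen (Set.Iic φ) Y)
    (f : X ⟶ Y) : f = 0 := by
  obtain ⟨L, hL, hP⟩ := hX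
  obtain ⟨L', hL', hP'⟩ := hY
  refine hL.hom_eq_zero_of_left (fun A hA => hL'.hom_eq_zero_of_right fun B hB => ?_) f
  obtain ⟨a, ha, rfl⟩ := List.mem_map.1 hA
  obtain ⟨b, hb, rfl⟩ := List.mem_map.1 hB
  exact σ.hom_zero _ _ _ _ (lt_of_le_of_lt (hP' b hb).1 (hP a ha).1) (hP a ha).2 (hP' b hb).2

/-- Truncations are unique up to isomorphism. -/
lemma iso_of_isExt {X Y X' Y' : D} {φ : ℝ} (hX : σ.Gen (Set.Ioi φ) X) (hY : σ.Gen (Set.Iic φ) Y)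
    (hX' : σ.Gen (Set.Ioi φ) X') (hY' : σ.Gen (Set.Iic φ) Y') (h : IsExt X E Y)
    (h' : IsExt X' E Y') : Nonempty (X ≅ X') := by
  have key : ∀ {X Y : D} {f : X ⟶ E} {g : E ⟶ Y} {d : Y ⟶ X⟦(1 : ℤ)⟧},
      σ.Gen (Set.Ioi φ) X → σ.Gen (Set.Iic φ) Y → Triangle.mk f g d ∈ distTriang D →
      ∀ α : X ⟶ X, α ≫ f = f → α = 𝟙 X := by
    intro X Y f g d hX hY hT α hα
    rw [← sub_eq_zero]
    apply (shiftFunctor D (1 : ℤ)).map_injective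
    -- The shifted difference factors through some `X⟦1⟧ ⟶ Y`, which vanishes because the phases of
    -- `X⟦1⟧` exceed `φ + 1`.
    obtain ⟨p, hp⟩ := Triangle.coyoneda_exact₁ _ hT ((α - 𝟙 X)⟦(1 : ℤ)⟧')
      (by
        change (α - 𝟙 X)⟦(1 : ℤ)⟧' ≫ f⟦(1 : ℤ)⟧' = 0
        rw [← Functor.map_comp, Preadditive.sub_comp, hα, Category.id_comp, sub_self,
          Functor.map_zero])
    have hX1 : σ.Gen (Set.Ioi φ) (X⟦(1 : ℤ)⟧) := hX.shift.mono fun x hx => by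
      simp only [Set.mem_preimage, Set.mem_Ioi] at hx ⊢
      linarith
    rw [Functor.map_zero]
    exact hp.trans ((congrArg (· ≫ d) (hX1.hom_eq_zero hY p)).trans zero_comp)
  obtain ⟨f, g, d, hT⟩ := h
  obtain ⟨f', g', d', hT'⟩ := h'
  obtain ⟨α, hα⟩ := Triangle.coyoneda_exact₂ _ hT' f (hX.hom_eq_zero hY' _)
  obtain ⟨β, hβ⟩ := Triangle.coyoneda_exact₂ _ hT f' (hX'.hom_eq_zero hY _)
  change X ⟶ X' at α
  change X' ⟶ X at β
  change f = α ≫ f' at hα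
  change f' = β ≫ f at hβ
  exact ⟨⟨α, β, key hX hY hT _ (by rw [Category.assoc, ← hβ, ← hα]),
    key hX' hY' hT' _ (by rw [Category.assoc, ← hα, ← hβ])⟩⟩

end Gen

variable (σ)

lemma exists_isHNFiltration (E : D) : ∃ L, IsHNFiltration σ.P E L := by
  by_cases h : IsZero E
  · exact ⟨[], .zero h, .nil, by simp⟩
  · exact σ.exists_hn E h

/-! ### Rotated charges and heights. -/

/-- The imaginary part of the central charge rotated by `-πφ`. -/
def rotIm (φ : ℝ) : K₀ D →+ ℝ :=
  Complex.imAddGroupHom.comp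
    ((AddMonoidHom.mulLeft (Complex.exp (-(Complex.I * Real.pi * φ)))).comp σ.Z)

/-- The real part of the central charge rotated by `-πφ`. -/
def rotRe (φ : ℝ) : K₀ D →+ ℝ :=
  Complex.reAddGroupHom.comp
    ((AddMonoidHom.mulLeft (Complex.exp (-(Complex.I * Real.pi * φ)))).comp σ.Z)

variable {σ} in
lemma rot_charge {ψ : ℝ} {E : D} (h : σ.P ψ E) (φ : ℝ) :
    Complex.exp (-(Complex.I * Real.pi * φ)) * σ.Z (K₀.cls E) =
      ‖σ.Z (K₀.cls E)‖ * Complex.exp ((Real.pi * (ψ - φ) : ℝ) * Complex.I) := by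
  by_cases h0 : IsZero E
  · simp [h0.cls_eq_zero]
  · obtain ⟨m, hm, hZ⟩ := σ.charge ψ E h h0
    have h1 : ‖Complex.exp (Complex.I * Real.pi * ψ)‖ = 1 := by
      rw [show Complex.I * Real.pi * ψ = (Real.pi * ψ : ℝ) * Complex.I by push_cast; ring,
        Complex.norm_exp_ofReal_mul_I]
    rw [hZ, norm_mul, h1, mul_left_comm, ← Complex.exp_add, Complex.norm_real,
      Real.norm_of_nonneg hm.le, mul_one]
    congr 2
    push_cast
    ring

variable {σ} in
lemma rotIm_cls {ψ : ℝ} {E : D} (h : σ.P ψ E) (φ : ℝ) :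
    σ.rotIm φ (K₀.cls E) = ‖σ.Z (K₀.cls E)‖ * Real.sin (Real.pi * (ψ - φ)) := by
  change (Complex.exp (-(Complex.I * Real.pi * φ)) * σ.Z (K₀.cls E)).im = _
  rw [rot_charge h, Complex.im_ofReal_mul, Complex.exp_ofReal_mul_I_im]

variable {σ} in
lemma rotRe_cls {ψ : ℝ} {E : D} (h : σ.P ψ E) (φ : ℝ) :
    σ.rotRe φ (K₀.cls E) = ‖σ.Z (K₀.cls E)‖ * Real.cos (Real.pi * (ψ - φ)) := by
  change (Complex.exp (-(Complex.I * Real.pi * φ)) * σ.Z (K₀.cls E)).re = _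
  rw [rot_charge h, Complex.re_ofReal_mul, Complex.exp_ofReal_mul_I_re]

/-- The imaginary part, after rotation by `-πφ`, of the charge of the factors in `L` of phase
greater than `φ`. -/
def height (φ : ℝ) (L : List (ℝ × D)) : ℝ :=
  (L.map fun a => ‖σ.Z (K₀.cls a.2)‖ * Real.sin (Real.pi * max (a.1 - φ) 0)).sum

/-- The mass of a list of factors. -/
def massSum (t : ℝ) (L : List (ℝ × D)) : ℝ :=
  (L.map fun a => ‖σ.Z (K₀.cls a.2)‖ * Real.exp (a.1 * t)).sum

lemma height_append (φ : ℝ) (L L' : List (ℝ × D)) :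
    σ.height φ (L ++ L') = σ.height φ L + σ.height φ L' := by
  simp [height]

lemma massSum_append (t : ℝ) (L L' : List (ℝ × D)) :
    σ.massSum t (L ++ L') = σ.massSum t L + σ.massSum t L' := by
  simp [massSum]

variable {σ}

/-- The truncation of `E` at phase `φ`, with the charge of its part of phase greater than `φ`. -/
lemma _root_.TriangulatedMass.IsHNFiltration.exists_trunc [IsTriangulated D] {E : D}
    {L : List (ℝ × D)} (h : IsHNFiltration σ.P E L) (φ : ℝ) :
    ∃ X Y, IsExt X E Y ∧ σ.Gen (Set.Ioi φ) X ∧ σ.Gen (Set.Iic φ) Y ∧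
      σ.rotIm φ (K₀.cls X) = σ.height φ L := by
  obtain ⟨hT, hL, hP⟩ := h
  induction L generalizing E with
  | nil =>
    cases hT with
    | zero h => exact ⟨E, E, IsExt.zero_left h (Iso.refl E), .of_isZero h, .of_isZero h,
        by simp [h.cls_eq_zero, height]⟩
  | cons a L ih =>
    rw [List.pairwise_cons] at hL
    -- The head `a` is the last cone and has the smallest phase: either it belongs to the quotient,
    -- or all phases exceed `φ` and the truncation is `E` itself.
    rcases le_or_gt a.1 φ with ha | ha
    · cases hT with
      | step h p q d hT =>
        obtain ⟨X, Y, hXY, hX, hY, hcls⟩ :=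
          ih h hL.2 fun b hb => hP b (List.mem_cons_of_mem _ hb)
        obtain ⟨C, hC, hC'⟩ := IsExt.quotient ⟨p, q, d, hT⟩ hXY
        refine ⟨X, C, hC, hX, hY.ext ⟨[a], Tower.single _, ?_⟩ hC', ?_⟩
        · simpa using ⟨ha, (hP a List.mem_cons_self).1⟩
        · simp [height, hcls, max_eq_right (sub_nonpos.2 ha)]
    · have hlt : ∀ b ∈ a :: L, φ < b.1 := by
        intro b hb
        rcases List.mem_cons.1 hb with rfl | hb
        exacts [ha, ha.trans (hL.1 b hb)]
      refine ⟨E, _, IsExt.zero_right (Iso.refl E) (isZero_zero D),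
        ⟨a :: L, hT, fun b hb => ⟨hlt b hb, (hP b hb).1⟩⟩, .of_isZero (isZero_zero D), ?_⟩
      rw [hT.cls, map_list_sum, List.map_map, List.map_map, height]
      refine congrArg List.sum (List.map_congr_left fun b hb => ?_)
      rw [Function.comp_apply, Function.comp_apply, rotIm_cls (hP b hb).1,
        max_eq_left (sub_nonneg.2 (hlt b hb).le)]

/-- Truncations are unique, so the height depends only on `E`. This stands in for uniqueness of the
Harder–Narasimhan filtration. -/
lemma _root_.TriangulatedMass.IsHNFiltration.height_eq [IsTriangulated D] {E X Y : D}
    {L : List (ℝ × D)} (h : IsHNFiltration σ.P E L) {φ : ℝ} (hXY : IsExt X E Y)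
    (hX : σ.Gen (Set.Ioi φ) X) (hY : σ.Gen (Set.Iic φ) Y) :
    σ.height φ L = σ.rotIm φ (K₀.cls X) := by
  obtain ⟨X', Y', hXY', hX', hY', hcls⟩ := h.exists_trunc φ
  obtain ⟨e⟩ := hX.iso_of_isExt hY hX' hY' hXY hXY'
  have := (IsExt.zero_right e (isZero_zero D)).cls
  rw [(isZero_zero D).cls_eq_zero, add_zero] at this
  rw [← hcls, this]

lemma rotIm_nonneg [IsTriangulated D] {Q : D} {φ : ℝ} (h : σ.Gen (Set.Ioi φ) Q)
    (h' : σ.Gen (Set.Iic (φ + 1)) Q) : 0 ≤ σ.rotIm φ (K₀.cls Q) := by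
  obtain ⟨L, hL⟩ := σ.exists_isHNFiltration Q
  have h1 := hL.height_eq (IsExt.zero_right (Iso.refl Q) (isZero_zero D)) h
    (.of_isZero (isZero_zero D))
  have h2 := hL.height_eq (IsExt.zero_left (isZero_zero D) (Iso.refl Q))
    (.of_isZero (isZero_zero D)) h'
  rw [(isZero_zero D).cls_eq_zero, map_zero] at h2
  -- The added height at `φ + 1` is zero. With it the sum is nonnegative term by term: factors of
  -- phase at least `φ + 1` cancel by `sin (x - π) = -sin x`, so their absence need not be proved.
  suffices 0 ≤ σ.height φ L + σ.height (φ + 1) L by linarith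
  rw [height, height, ← List.sum_map_add]
  refine List.sum_nonneg fun x hx => ?_
  obtain ⟨a, -, rfl⟩ := List.mem_map.1 hx
  rw [← mul_add]
  refine mul_nonneg (norm_nonneg _) ?_
  rcases le_total (a.1 - φ) 0 with h0 | h0
  · rw [max_eq_right h0, max_eq_right (by linarith)]
    simp
  rcases le_total (a.1 - (φ + 1)) 0 with h3 | h3
  · rw [max_eq_left h0, max_eq_right h3, mul_zero, Real.sin_zero, add_zero]
    exact Real.sin_nonneg_of_nonneg_of_le_pi (by positivity)
      (mul_le_of_le_one_right Real.pi_pos.le (by linarith))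
  · rw [max_eq_left h0, max_eq_left h3,
      show Real.pi * (a.1 - (φ + 1)) = Real.pi * (a.1 - φ) - Real.pi by ring, Real.sin_sub_pi]
    simp

/-- Let `E₁` be the preimage of `XB` in `E` and `E₂ = E₁ / XA`, an extension of `XB` by `YA`. The
truncation of `E` is an extension of `X₂ = τ_{>φ} E₂` by `XA`, so it remains to compare `X₂` with
`XB`. The cone `Q` of `X₂ ⟶ XB` is an extension of `X₂⟦1⟧` by `XB` and of `YA⟦1⟧` by `Y₂`, so its
phases lie in `(φ, φ + 1]` and `rotIm_nonneg` applies. -/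
lemma height_le [IsTriangulated D] {A E B : D} {LA LE LB : List (ℝ × D)} (h : IsExt A E B)
    (hA : IsHNFiltration σ.P A LA) (hE : IsHNFiltration σ.P E LE)
    (hB : IsHNFiltration σ.P B LB) (φ : ℝ) :
    σ.height φ LE ≤ σ.height φ LA + σ.height φ LB := by
  obtain ⟨XA, YA, hA', hXA, hYA, hAcls⟩ := hA.exists_trunc φ
  obtain ⟨XB, YB, hB', hXB, hYB, hBcls⟩ := hB.exists_trunc φ
  obtain ⟨E₁, hE₁, hE₁'⟩ := h.preimage hB'
  obtain ⟨E₂, hE₂, hE₂'⟩ := hE₁'.quotient hA'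
  obtain ⟨L₂, hL₂⟩ := σ.exists_isHNFiltration E₂
  obtain ⟨X₂, Y₂, h₂, hX₂, hY₂, -⟩ := hL₂.exists_trunc φ
  obtain ⟨X, hX, hX'⟩ := hE₂.preimage h₂
  obtain ⟨Y, hY, hY'⟩ := hE₁.quotient hX
  obtain ⟨Q, hQ, hQ'⟩ := hE₂'.rotate.quotient h₂
  have hle : Set.Ioi (φ + 1) ⊆ Set.Ioi φ := Set.Ioi_subset_Ioi (by linarith)
  have hle' : Set.Iic φ ⊆ Set.Iic (φ + 1) := Set.Iic_subset_Iic.2 (by linarith)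
  have hQ0 : 0 ≤ σ.rotIm φ (K₀.cls Q) := by
    refine rotIm_nonneg (hXB.ext (hX₂.shift.mono fun x hx => ?_) hQ.rotate)
      ((hY₂.mono hle').ext (hYA.shift.mono fun x hx => ?_) hQ')
    · simp only [Set.mem_preimage, Set.mem_Ioi] at hx ⊢
      linarith
    · simp only [Set.mem_preimage, Set.mem_Iic] at hx ⊢
      linarith
  rw [hE.height_eq hY (hXA.ext hX₂ hX') (hY₂.ext hYB hY'), ← hAcls, ← hBcls, hX'.cls, hQ.cls,
    map_add, map_add]
  linarith

lemma height_biprod [IsTriangulated D] {A B : D} {LA LE LB : List (ℝ × D)}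
    (hA : IsHNFiltration σ.P A LA) (hE : IsHNFiltration σ.P (A ⊞ B) LE)
    (hB : IsHNFiltration σ.P B LB) (φ : ℝ) :
    σ.height φ LE = σ.height φ LA + σ.height φ LB := by
  obtain ⟨XA, YA, hA', hXA, hYA, hAcls⟩ := hA.exists_trunc φ
  obtain ⟨XB, YB, hB', hXB, hYB, hBcls⟩ := hB.exists_trunc φ
  rw [hE.height_eq (hA'.biprod_biprod hB') (hXA.ext hXB (.biprod _ _))
    (hYA.ext hYB (.biprod _ _)), ← hAcls, ← hBcls, (IsExt.biprod XA XB).cls, map_add]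

/-! ### The mass as an integral of heights. -/

/-- The integrand vanishes beyond `a`. Below `a` it has an elementary primitive, whose value at `a`
yields the exponential and whose value at `R` will become the term depending only on the class. -/
lemma integral_exp_mul_sin_max (t : ℝ) {R S a : ℝ} (hR : R ≤ a) (hS : a ≤ S) :
    ∫ φ in R..S, Real.exp (t * φ) * Real.sin (Real.pi * max (a - φ) 0) =
      (Real.pi * Real.exp (a * t) - Real.exp (t * R) *
        (t * Real.sin (Real.pi * (a - R)) + Real.pi * Real.cos (Real.pi * (a - R)))) /
        (t ^ 2 + Real.pi ^ 2) := by
  have hc : Continuous fun φ => Real.exp (t * φ) * Real.sin (Real.pi * max (a - φ) 0) := by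
    fun_prop
  have h0 : t ^ 2 + Real.pi ^ 2 ≠ 0 := by positivity
  rw [← intervalIntegral.integral_add_adjacent_intervals (hc.intervalIntegrable R a)
    (hc.intervalIntegrable a S)]
  have h1 : ∫ φ in a..S, Real.exp (t * φ) * Real.sin (Real.pi * max (a - φ) 0) = 0 := by
    rw [← intervalIntegral.integral_zero (a := a) (b := S)]
    refine intervalIntegral.integral_congr fun φ hφ => ?_
    rw [Set.uIcc_of_le hS] at hφ
    simp [max_eq_right (sub_nonpos.2 hφ.1)]
  have h2 : ∫ φ in R..a, Real.exp (t * φ) * Real.sin (Real.pi * max (a - φ) 0) =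
      ∫ φ in R..a, Real.exp (t * φ) * Real.sin (Real.pi * (a - φ)) := by
    refine intervalIntegral.integral_congr fun φ hφ => ?_
    rw [Set.uIcc_of_le hR] at hφ
    simp only [max_eq_left (sub_nonneg.2 hφ.2)]
  have h3 : ∀ φ : ℝ, HasDerivAt (fun φ => Real.exp (t * φ) *
      (t * Real.sin (Real.pi * (a - φ)) + Real.pi * Real.cos (Real.pi * (a - φ))) /
        (t ^ 2 + Real.pi ^ 2)) (Real.exp (t * φ) * Real.sin (Real.pi * (a - φ))) φ := by
    intro φ
    have e1 : HasDerivAt (fun φ : ℝ => t * φ) t φ := by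
      simpa using (hasDerivAt_id φ).const_mul t
    have e2 : HasDerivAt (fun φ : ℝ => Real.pi * (a - φ)) (-Real.pi) φ := by
      simpa using ((hasDerivAt_id φ).const_sub a).const_mul Real.pi
    have e3 := (e1.exp.mul ((e2.sin.const_mul t).add (e2.cos.const_mul Real.pi))).div_const
      (t ^ 2 + Real.pi ^ 2)
    refine e3.congr_deriv ?_
    field_simp
    simp only [Pi.add_apply]
    ring
  rw [h1, h2, intervalIntegral.integral_eq_sub_of_hasDerivAt (fun φ _ => h3 φ)
    (Continuous.intervalIntegrable (by fun_prop) _ _)]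
  simp only [sub_self, mul_zero, Real.sin_zero, Real.cos_zero]
  field_simp
  ring_nf

lemma continuous_height (L : List (ℝ × D)) : Continuous fun φ => σ.height φ L := by
  unfold height
  induction L with
  | nil => simpa using continuous_const
  | cons a L ih =>
    simp only [List.map_cons, List.sum_cons]
    exact Continuous.add (by fun_prop) ih

/-- The mass as an integral of the heights, up to a term which only depends on the class. -/
lemma massSum_eq (t : ℝ) {R S : ℝ} {L : List (ℝ × D)} (hP : ∀ a ∈ L, σ.P a.1 a.2)
    (hRS : ∀ a ∈ L, R ≤ a.1 ∧ a.1 ≤ S) :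
    σ.massSum t L = (t ^ 2 + Real.pi ^ 2) / Real.pi *
        (∫ φ in R..S, Real.exp (t * φ) * σ.height φ L) +
      Real.exp (t * R) / Real.pi * (t * σ.rotIm R (L.map fun a => K₀.cls a.2).sum +
        Real.pi * σ.rotRe R (L.map fun a => K₀.cls a.2).sum) := by
  induction L with
  | nil => simp [massSum, height]
  | cons a L ih =>
    have ih := ih (fun b hb => hP b (List.mem_cons_of_mem _ hb))
      (fun b hb => hRS b (List.mem_cons_of_mem _ hb))
    have h1 : ∀ φ, Real.exp (t * φ) * σ.height φ (a :: L) = ‖σ.Z (K₀.cls a.2)‖ *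
        (Real.exp (t * φ) * Real.sin (Real.pi * max (a.1 - φ) 0)) +
        Real.exp (t * φ) * σ.height φ L := by
      intro φ
      simp only [height, List.map_cons, List.sum_cons]
      ring
    have ha := hRS a List.mem_cons_self
    have hc := continuous_height (σ := σ) L
    simp only [h1]
    rw [intervalIntegral.integral_add (Continuous.intervalIntegrable (by fun_prop) _ _)
      (Continuous.intervalIntegrable (by fun_prop) _ _), intervalIntegral.integral_const_mul,
      integral_exp_mul_sin_max t ha.1 ha.2]
    simp only [List.map_cons, List.sum_cons, map_add, rotIm_cls (hP a List.mem_cons_self),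
      rotRe_cls (hP a List.mem_cons_self)]
    have h2 : σ.massSum t (a :: L) = ‖σ.Z (K₀.cls a.2)‖ * Real.exp (a.1 * t) + σ.massSum t L := by
      simp [massSum]
    rw [h2, ih]
    have h0 : t ^ 2 + Real.pi ^ 2 ≠ 0 := by positivity
    field_simp
    ring

lemma massSum_le (t : ℝ) {L L' : List (ℝ × D)} (hP : ∀ a ∈ L, σ.P a.1 a.2)
    (hP' : ∀ a ∈ L', σ.P a.1 a.2)
    (hcls : (L.map fun a => K₀.cls a.2).sum = (L'.map fun a => K₀.cls a.2).sum)
    (h : ∀ φ, σ.height φ L ≤ σ.height φ L') : σ.massSum t L ≤ σ.massSum t L' := by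
  have hfin : {φ | ∃ a ∈ L ++ L', a.1 = φ}.Finite := by
    simpa only [List.mem_map] using ((L ++ L').map Prod.fst).finite_toSet
  obtain ⟨R, hR⟩ := hfin.bddBelow
  obtain ⟨S, hS⟩ := hfin.bddAbove
  -- `max R S` keeps the interval oriented even when both lists are empty.
  have hRS : ∀ a ∈ L ++ L', R ≤ a.1 ∧ a.1 ≤ max R S := fun a ha =>
    ⟨hR ⟨a, ha, rfl⟩, (hS ⟨a, ha, rfl⟩).trans (le_max_right _ _)⟩
  rw [massSum_eq t hP (fun a ha => hRS a (List.mem_append_left _ ha)),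
    massSum_eq t hP' (fun a ha => hRS a (List.mem_append_right _ ha)), hcls]
  gcongr
  have hc := continuous_height (σ := σ) L
  have hc' := continuous_height (σ := σ) L'
  refine intervalIntegral.integral_mono (le_max_left _ _)
    (Continuous.intervalIntegrable (by fun_prop) _ _)
    (Continuous.intervalIntegrable (by fun_prop) _ _) fun φ => ?_
  exact mul_le_mul_of_nonneg_left (h φ) (Real.exp_pos _).le

lemma massSum_nonneg (t : ℝ) (L : List (ℝ × D)) : 0 ≤ σ.massSum t L :=
  List.sum_nonneg fun x hx => by
    obtain ⟨a, -, rfl⟩ := List.mem_map.1 hx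
    positivity

lemma _root_.TriangulatedMass.IsHNFiltration.sum_cls {E : D} {L : List (ℝ × D)}
    (h : IsHNFiltration σ.P E L) : (L.map fun a => K₀.cls a.2).sum = K₀.cls E := by
  rw [h.tower.cls, List.map_map]
  rfl

/-! ### Properties of the mass. -/

lemma _root_.TriangulatedMass.IsHNFiltration.mass_eq [IsTriangulated D] {E : D}
    {L : List (ℝ × D)} (h : IsHNFiltration σ.P E L) (t : ℝ) : σ.mass t E = σ.massSum t L := by
  have key : ∀ {L L' : List (ℝ × D)}, IsHNFiltration σ.P E L → IsHNFiltration σ.P E L' →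
      σ.massSum t L ≤ σ.massSum t L' := fun h h' =>
    massSum_le t (fun a ha => (h.semistable a ha).1) (fun a ha => (h'.semistable a ha).1)
      (h.sum_cls.trans h'.sum_cls.symm) fun φ => by
        obtain ⟨X, Y, hXY, hX, hY, -⟩ := h.exists_trunc φ
        rw [h.height_eq hXY hX hY, h'.height_eq hXY hX hY]
  unfold mass
  split_ifs with h0
  · exact (le_antisymm (key (L' := []) h ⟨.zero h0, .nil, by simp⟩) (massSum_nonneg t L)).symm
  · exact le_antisymm (key (σ.exists_hn E h0).choose_spec h) (key h (σ.exists_hn E h0).choose_spec)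

lemma mass_of_isZero (σ : StabilityCondition D) (t : ℝ) {E : D} (hE : IsZero E) :
    σ.mass t E = 0 := dif_pos hE

lemma mass_le_add [IsTriangulated D] (σ : StabilityCondition D) (t : ℝ) {A E B : D}
    (h : IsExt A E B) : σ.mass t E ≤ σ.mass t A + σ.mass t B := by
  obtain ⟨LA, hA⟩ := σ.exists_isHNFiltration A
  obtain ⟨LE, hE⟩ := σ.exists_isHNFiltration E
  obtain ⟨LB, hB⟩ := σ.exists_isHNFiltration B
  rw [hA.mass_eq, hE.mass_eq, hB.mass_eq, ← massSum_append]
  -- The concatenated list need not be a Harder–Narasimhan filtration; `massSum_le` needs only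
  -- semistable entries and equal total classes.
  refine massSum_le t (fun a ha => (hE.semistable a ha).1) (fun a ha => ?_) ?_ fun φ => ?_
  · rcases List.mem_append.1 ha with ha | ha
    exacts [(hA.semistable a ha).1, (hB.semistable a ha).1]
  · rw [List.map_append, List.sum_append, hE.sum_cls, hA.sum_cls, hB.sum_cls, h.cls]
  · rw [height_append]
    exact height_le h hA hE hB φ

lemma mass_le_biprod [IsTriangulated D] (σ : StabilityCondition D) (t : ℝ) (A B : D) :
    σ.mass t A ≤ σ.mass t (A ⊞ B) := by
  obtain ⟨LA, hA⟩ := σ.exists_isHNFiltration A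
  obtain ⟨LE, hE⟩ := σ.exists_isHNFiltration (A ⊞ B)
  obtain ⟨LB, hB⟩ := σ.exists_isHNFiltration B
  rw [hA.mass_eq, hE.mass_eq]
  refine (le_add_of_nonneg_right (massSum_nonneg (σ := σ) t LB)).trans ?_
  rw [← massSum_append]
  refine massSum_le t (fun a ha => ?_) (fun a ha => (hE.semistable a ha).1) ?_ fun φ => ?_
  · rcases List.mem_append.1 ha with ha | ha
    exacts [(hA.semistable a ha).1, (hB.semistable a ha).1]
  · rw [List.map_append, List.sum_append, hE.sum_cls, hA.sum_cls, hB.sum_cls,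
      (IsExt.biprod A B).cls]
  · rw [height_append, height_biprod hA hE hB φ]

lemma mass_congr [IsTriangulated D] (σ : StabilityCondition D) (t : ℝ) {E E' : D} (e : E ≅ E') :
    σ.mass t E = σ.mass t E' := by
  obtain ⟨L, hL⟩ := σ.exists_isHNFiltration E
  rw [hL.mass_eq, IsHNFiltration.mass_eq ⟨hL.tower.of_iso e, hL.phases, hL.semistable⟩]

lemma mass_shift_one [IsTriangulated D] (σ : StabilityCondition D) (t : ℝ) (E : D) :
    σ.mass t (E⟦(1 : ℤ)⟧) = Real.exp t * σ.mass t E := by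
  obtain ⟨L, hL⟩ := σ.exists_isHNFiltration E
  have hL' : IsHNFiltration σ.P (E⟦(1 : ℤ)⟧) (L.map fun a => (a.1 + 1, a.2⟦(1 : ℤ)⟧)) := by
    refine ⟨?_, ?_, ?_⟩
    · simpa [Function.comp_def] using hL.tower.shift 1
    · simpa [List.pairwise_map] using hL.phases
    · simp only [List.mem_map, forall_exists_index, and_imp, forall_apply_eq_imp_iff₂]
      refine fun a ha => ⟨(σ.shift _ _).2 (hL.semistable a ha).1, fun h => ?_⟩
      refine (hL.semistable a ha).2 ?_
      exact ((shiftFunctor D (-1 : ℤ)).map_isZero h).of_iso (shiftShiftNeg a.2 (1 : ℤ)).symm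
  rw [hL.mass_eq, hL'.mass_eq, massSum, massSum, ← List.sum_map_mul_left, List.map_map]
  refine congrArg List.sum (List.map_congr_left fun a _ => ?_)
  have hcls : K₀.cls (a.2⟦(1 : ℤ)⟧) = -K₀.cls a.2 := by
    have h0 := (IsExt.zero_right (Iso.refl a.2) (isZero_zero D)).rotate.cls
    rw [(isZero_zero D).cls_eq_zero] at h0
    exact (neg_eq_of_add_eq_zero_right h0.symm).symm
  simp only [Function.comp_apply, hcls, map_neg, norm_neg, add_mul, one_mul, Real.exp_add]
  ring

lemma mass_shift [IsTriangulated D] (σ : StabilityCondition D) (t : ℝ) (E : D) (n : ℤ) :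
    σ.mass t (E⟦n⟧) = Real.exp (n * t) * σ.mass t E := by
  have h : ∀ n : ℤ, σ.mass t (E⟦n + 1⟧) = Real.exp t * σ.mass t (E⟦n⟧) := fun n => by
    rw [σ.mass_congr t ((shiftFunctorAdd D n 1).app E)]
    exact σ.mass_shift_one t _
  induction n using Int.induction_on with
  | zero => simpa using σ.mass_congr t ((shiftFunctorZero D ℤ).app E)
  | succ n ih =>
    rw [h, ih, ← mul_assoc, ← Real.exp_add]
    congr 2
    push_cast
    ring
  | pred n ih =>
    have h1 := h (-n - 1)
    rw [sub_add_cancel, ih] at h1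
    refine mul_left_cancel₀ (Real.exp_ne_zero t) ?_
    rw [← h1, ← mul_assoc, ← Real.exp_add]
    congr 2
    push_cast
    ring

lemma mass_le_sum [IsTriangulated D] (σ : StabilityCondition D) (t : ℝ) {E : D} {L : List D}
    (h : Tower E L) : σ.mass t E ≤ (L.map (σ.mass t)).sum := by
  induction h using Tower.induction_ext with
  | zero h => simp [σ.mass_of_isZero t h]
  | step _ h' ih =>
    rw [List.map_cons, List.sum_cons, add_comm]
    exact (σ.mass_le_add t h').trans (by gcongr)

/-- The mass of an object built from shifts of `G` is bounded by that of `G`. -/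
lemma mass_le_mul [IsTriangulated D] (σ : StabilityCondition D) (t : ℝ) {E G : D} {ns : List ℤ}
    (h : Built E (ns.map fun n => G⟦n⟧)) :
    σ.mass t E ≤ (ns.map fun n : ℤ => Real.exp (n * t)).sum * σ.mass t G := by
  obtain ⟨E', h⟩ := h.exists_biprod
  refine (σ.mass_le_biprod t E E').trans ((σ.mass_le_sum t h).trans_eq ?_)
  rw [← List.sum_map_mul_right, List.map_map]
  exact congrArg List.sum (List.map_congr_left fun n _ => σ.mass_shift t G n)

end StabilityCondition

/-! ### Complexity and its submultiplicativity. -/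

/-- The weight `∑ exp (n t)` of a list of shifts. -/
def cost (t : ℝ) (ns : List ℤ) : ℝ := (ns.map fun n : ℤ => Real.exp (n * t)).sum

lemma cost_nonneg (t : ℝ) (ns : List ℤ) : 0 ≤ cost t ns :=
  List.sum_nonneg fun x hx => by
    obtain ⟨a, -, rfl⟩ := List.mem_map.1 hx
    positivity

/-- The complexity of `E₂` relative to `E₁`, in terms of direct summands of towers. -/
def builtCost (t : ℝ) (E₁ E₂ : D) : ℝ≥0∞ :=
  ⨅ (ns : List ℤ) (_ : Built E₂ (ns.map fun n => E₁⟦n⟧)), ENNReal.ofReal (cost t ns)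

lemma complexity_eq_builtCost (t : ℝ) {E₁ E₂ : D} (h : thick E₁ E₂) :
    complexity t E₁ E₂ = builtCost t E₁ E₂ := by
  unfold complexity
  split_ifs with h0
  · refine (le_antisymm ?_ zero_le).symm
    exact (iInf₂_le [] (.of_tower (.zero h0))).trans (by simp [cost])
  · refine le_antisymm (le_iInf₂ fun ns hns => ?_)
      (le_iInf fun ns => le_iInf₂ fun E' hE' => ?_)
    · obtain ⟨E', hE'⟩ := hns.exists_biprod
      refine (iInf_le_of_le ns (iInf₂_le E' hE')).trans_eq ?_
      simp [cost, List.map_eq_flatMap, List.flatMap_assoc]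
    · refine (iInf₂_le ns (.of_biprod hE')).trans_eq ?_
      simp [cost, List.map_eq_flatMap, List.flatMap_assoc]

lemma builtCost_ne_top [IsTriangulated D] (t : ℝ) {E₁ E₂ : D} (h : thick E₁ E₂) :
    builtCost t E₁ E₂ ≠ ⊤ := by
  obtain ⟨ns, hns⟩ := Built.of_thick h
  exact ((iInf₂_le ns hns).trans_lt ENNReal.ofReal_lt_top).ne

/-- Objects built from an object built from shifts of `E₁` are built from shifts of `E₁`. -/
lemma Built.trans [IsTriangulated D] {E₁ E₂ E₃ : D} {ns ms : List ℤ}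
    (h : Built E₂ (ns.map fun n => E₁⟦n⟧)) (h' : Built E₃ (ms.map fun n => E₂⟦n⟧)) :
    Built E₃ ((ms.flatMap fun m => ns.map (· + m)).map fun n => E₁⟦n⟧) := by
  obtain ⟨W, hW, ⟨r⟩⟩ := h'
  refine Built.of_retract ?_ r
  clear r
  induction ms generalizing W with
  | nil => exact .of_tower hW
  | cons m ms ih =>
    cases hW with
    | step hV p q d hT =>
      rw [List.flatMap_cons, List.map_append]
      refine (ih _ hV).append ((h.shift m).congr ?_) ⟨p, q, d, hT⟩
      simp only [List.map_map, List.forall₂_map_left_iff, List.forall₂_map_right_iff,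
        List.forall₂_same]
      exact fun n _ => ⟨((shiftFunctorAdd D n m).app E₁).symm⟩

lemma cost_flatMap (t : ℝ) (ns ms : List ℤ) :
    cost t (ms.flatMap fun m => ns.map (· + m)) = cost t ns * cost t ms := by
  induction ms with
  | nil => simp [cost]
  | cons m ms ih =>
    have h1 : cost t (ns.map (· + m)) = cost t ns * Real.exp (m * t) := by
      rw [cost, cost, ← List.sum_map_mul_right, List.map_map]
      refine congrArg List.sum (List.map_congr_left fun n _ => ?_)
      simp [add_mul, Real.exp_add]
    have h2 : ∀ l l' : List ℤ, cost t (l ++ l') = cost t l + cost t l' := by simp [cost]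
    rw [List.flatMap_cons, h2, ih, h1]
    simp only [cost, List.map_cons, List.sum_cons]
    ring

/-- Substituting a tower for `E₂` into one for `E₃` multiplies the weights. Finiteness excludes the
product `0 * ∞`. -/
lemma builtCost_le_mul [IsTriangulated D] (t : ℝ) {E₁ E₂ E₃ : D}
    (h : builtCost t E₁ E₂ ≠ ⊤) (h' : builtCost t E₂ E₃ ≠ ⊤) :
    builtCost t E₁ E₃ ≤ builtCost t E₁ E₂ * builtCost t E₂ E₃ := by
  refine ENNReal.le_mul_of_forall_lt (.inr h') (.inl h) fun a ha b hb => ?_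
  obtain ⟨ns, hns⟩ := iInf_lt_iff.1 ha
  obtain ⟨hB, hns⟩ := iInf_lt_iff.1 hns
  obtain ⟨ms, hms⟩ := iInf_lt_iff.1 hb
  obtain ⟨hB', hms⟩ := iInf_lt_iff.1 hms
  refine (iInf₂_le (f := fun ns _ => ENNReal.ofReal (cost t ns)) _ (hB.trans hB')).trans ?_
  rw [cost_flatMap, ENNReal.ofReal_mul (cost_nonneg t ns)]
  exact mul_le_mul' hns.le hms.le

/-! ### Iterates of the functor and entropy. -/

variable (F : D ⥤ D) [F.CommShift ℤ] [F.IsTriangulated]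

lemma Built.iterate {E G : D} {ns : List ℤ} (h : Built E (ns.map fun n => G⟦n⟧)) (k : ℕ) :
    Built (F.obj^[k] E) (ns.map fun n => (F.obj^[k] G)⟦n⟧) := by
  induction k with
  | zero => exact h
  | succ k ih =>
    rw [Function.iterate_succ_apply', Function.iterate_succ_apply']
    refine (ih.map F).congr ?_
    simp only [List.map_map, List.forall₂_map_left_iff, List.forall₂_map_right_iff,
      List.forall₂_same]
    exact fun n _ => ⟨(F.commShiftIso n).app _⟩

lemma builtCost_iterate_le (t : ℝ) (E₁ E₂ : D) (k : ℕ) :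
    builtCost t (F.obj^[k] E₁) (F.obj^[k] E₂) ≤ builtCost t E₁ E₂ :=
  le_iInf₂ fun ns h => iInf₂_le ns (h.iterate F k)

lemma builtCost_iterate_ne_top [IsTriangulated D] (t : ℝ) {G : D} (hG : IsSplitGenerator G)
    (k : ℕ) (E : D) : builtCost t (F.obj^[k] G) (F.obj^[k] E) ≠ ⊤ :=
  ne_top_of_le_ne_top (builtCost_ne_top t (hG E)) (builtCost_iterate_le F t G E k)

/-- The growth rate of the complexity of `Fⁿ G` exists and is not `∞`. -/
lemma exists_tendsto_log_builtCost_div [IsTriangulated D] (t : ℝ) {G : D} (hG : IsSplitGenerator G) :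
    ∃ h : EReal, Tendsto (fun n : ℕ => ENNReal.log (builtCost t G (F.obj^[n] G)) / (n : EReal))
      atTop (𝓝 h) ∧ h < ⊤ := by
  refine exists_tendsto_log_div (fun n => builtCost_ne_top t (hG _)) fun m n => ?_
  rw [Function.iterate_add_apply]
  exact (builtCost_le_mul t (builtCost_ne_top t (hG _)) (builtCost_iterate_ne_top F t hG m _)).trans
    (mul_le_mul' le_rfl (builtCost_iterate_le F t _ _ m))

/-- Pass from `G'` to `G`, then to `Fⁿ G`, then to `Fⁿ G'`; the last step costs at most as much as
from `G` to `G'`. -/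
lemma builtCost_le_const_mul [IsTriangulated D] (t : ℝ) {G G' : D} (hG : IsSplitGenerator G)
    (hG' : IsSplitGenerator G') (n : ℕ) :
    builtCost t G' (F.obj^[n] G') ≤
      builtCost t G' G * builtCost t G G' * builtCost t G (F.obj^[n] G) := by
  calc
    _ ≤ builtCost t G' (F.obj^[n] G) * builtCost t (F.obj^[n] G) (F.obj^[n] G') :=
      builtCost_le_mul t (builtCost_ne_top t (hG' _)) (builtCost_iterate_ne_top F t hG n _)
    _ ≤ builtCost t G' G * builtCost t G (F.obj^[n] G) * builtCost t G G' :=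
      mul_le_mul' (builtCost_le_mul t (builtCost_ne_top t (hG' _)) (builtCost_ne_top t (hG _)))
        (builtCost_iterate_le F t _ _ n)
    _ = _ := by ring

lemma StabilityCondition.ofReal_mass_le [IsTriangulated D] (σ : StabilityCondition D) (t : ℝ)
    (E G : D) :
    ENNReal.ofReal (σ.mass t E) ≤ (ENNReal.ofReal (σ.mass t G) + 1) * builtCost t G E := by
  -- The `+ 1` makes the factor nonzero, so dividing by it reduces the claim to a bound for each
  -- tower.
  rw [mul_comm, ← ENNReal.div_le_iff (by simp) (by simp)]
  refine le_iInf₂ fun ns h => ?_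
  rw [ENNReal.div_le_iff (by simp) (by simp)]
  refine (ENNReal.ofReal_le_ofReal (σ.mass_le_mul t h)).trans ?_
  rw [← cost, ENNReal.ofReal_mul (cost_nonneg t ns)]
  exact mul_le_mul' le_rfl le_self_add

end TriangulatedMass

end

theorem theorem3p4 {D : Type u} [Category.{v} D] [HasZeroObject D] [HasShift D ℤ]
    [Preadditive D] [∀ n : ℤ, (shiftFunctor D n).Additive] [Pretriangulated D]
    [IsTriangulated D]
    [Module.Free ℤ (TriangulatedMass.K₀ D)] [Module.Finite ℤ (TriangulatedMass.K₀ D)]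
    (G : D) (hG : TriangulatedMass.IsSplitGenerator G)
    (F : D ⥤ D) [F.CommShift ℤ] [F.IsTriangulated]
    (σ : TriangulatedMass.StabilityCondition D) (t : ℝ) :
    σ.massGrowth t F =
        limsup (fun n : ℕ =>
          ENNReal.log (ENNReal.ofReal (σ.mass t (F.obj^[n] G))) / (n : EReal)) atTop ∧
      ∃ h : EReal, TriangulatedMass.IsEntropy F t h ∧ σ.massGrowth t F ≤ h ∧ h < ⊤ := by
  open TriangulatedMass in
  have hgrowth : σ.massGrowth t F = σ.massGrowthAt t F G := by
    refine le_antisymm (iSup_le fun E => ?_) (le_iSup (σ.massGrowthAt t F) G)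
    -- A single list of shifts works for all `n`, so the constant is independent of `n`.
    obtain ⟨ns, hns⟩ := Built.of_thick (hG E)
    refine limsup_log_div_le (c := ENNReal.ofReal (cost t ns)) ENNReal.ofReal_ne_top fun n => ?_
    rw [← ENNReal.ofReal_mul (cost_nonneg t ns)]
    exact ENNReal.ofReal_le_ofReal (σ.mass_le_mul t (hns.iterate F n))
  open TriangulatedMass in
  obtain ⟨h, hlim, htop⟩ := exists_tendsto_log_builtCost_div F t hG
  refine ⟨hgrowth, h, ⟨⟨G, hG⟩, fun G' hG' => ?_⟩, ?_, htop⟩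
  · simp only [TriangulatedMass.complexity_eq_builtCost t (hG' _)]
    obtain ⟨h', hlim', -⟩ := TriangulatedMass.exists_tendsto_log_builtCost_div F t hG'
    have hfin := TriangulatedMass.builtCost_ne_top t (hG G')
    have hfin' := TriangulatedMass.builtCost_ne_top t (hG' G)
    convert hlim'
    rw [← hlim.limsup_eq, ← hlim'.limsup_eq]
    exact le_antisymm
      (TriangulatedMass.limsup_log_div_le (ENNReal.mul_ne_top hfin hfin')
        fun n => TriangulatedMass.builtCost_le_const_mul F t hG' hG n)
      (TriangulatedMass.limsup_log_div_le (ENNReal.mul_ne_top hfin' hfin)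
        fun n => TriangulatedMass.builtCost_le_const_mul F t hG hG' n)
  · rw [hgrowth, ← hlim.limsup_eq]
    exact TriangulatedMass.limsup_log_div_le (by simp) fun n => σ.ofReal_mass_le t _ G
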